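/- For a weakly decreasing sequence $\mathbf{t}=(t_1\ge t_2\ge\cdots\ge 0)$ of real numbers with $|\mathbf{t}|_2:=\left(\sum_{k\ge1}t_k^2\right)^{1/2}<\infty$, let $\mathcal{S}_{\mathbf{t}}:=\sum_{k\ge 1}\mathcal{U}\left[-\frac{t_k}{2},\frac{t_k}{2}\right]$ be the almost surely convergent sum of independent random variables, the $k$-th one uniformly distributed on $\left[-\frac{t_k}{2},\frac{t_k}{2}\right]$ (and equal to $0$ if $t_k=0$). For $\sigma\ge 0$, let $\mathcal{S}_{\mathbf{t}}+\mathcal{N}(0,\sigma^2)$ denote the probability distribution on $\mathbb{R}$ of the sum of $\mathcal{S}_{\mathbf{t}}$ and an independent normal random variable with mean $0$ and variance $\sigma^2$ (equal to $0$ if $\sigma=0$). Let $$\mathbf{P}:=\left\{\mathbf{t}=(t_1\ge t_2\ge\cdots\ge0)\,:\,|\mathbf{t}|_2^2\le 12\right\}\subset\mathbb{R}^{\mathbb{N}}$$ with the topology of pointwise convergence, and let $$\mathbf{M}:=\left\{\mathcal{S}_{\mathbf{t}}+\mathcal{N}(0,\sigma^2)\,:\,t_1\ge t_2\ge\cdots\ge0,\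 |\mathbf{t}|_2<\infty,\ \sigma\ge0,\ \tfrac{|\mathbf{t}|_2^2}{12}+\sigma^2=1\right\}$$ be the moduli space of standardized DUSTPAN distributions, with the topology given by the Lévy metric $$d(\mu,\nu)=\inf\{\varepsilon>0 : F_\mu(x-\varepsilon)-\varepsilon\le F_\nu(x)\le F_\mu(x+\varepsilon)+\varepsilon\ \text{for all }x\in\mathbb{R}\},$$ where $F_\mu$, $F_\nu$ are the cumulative distribution functions. Theorem. The spaces $\mathbf{P}$ and $\mathbf{M}$ are compact, and the map $\Phi:\mathbf{P}\to\mathbf{M}$ given by $\mathbf{t}\mapsto\mathcal{S}_{\mathbf{t}}+\mathcal{N}(0,\sigma^2)$ with $\sigma:=\sqrt{1-|\mathbf{t}|_2^2/12}$ is a homeomorphism. -/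

import Mathlib

open MeasureTheory ProbabilityTheory Filter Topology

noncomputable section

/-! ### The Lévy metric on probability distributions on the real line -/

/-- The set of `ε > 0` with `F_μ(x - ε) - ε ≤ F_ν(x) ≤ F_μ(x + ε) + ε` for all real `x`, where
`F_μ`, `F_ν` are the cumulative distribution functions. -/
def levySet (μ ν : ProbabilityMeasure ℝ) : Set ℝ :=
  {ε : ℝ | 0 < ε ∧ ∀ x : ℝ, cdf (μ : Measure ℝ) (x - ε) - ε ≤ cdf (ν : Measure ℝ) x ∧
    cdf (ν : Measure ℝ) x ≤ cdf (μ : Measure ℝ) (x + ε) + ε}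

/-- The Lévy distance. -/
def levyDist (μ ν : ProbabilityMeasure ℝ) : ℝ := sInf (levySet μ ν)

lemma levySet_bddBelow (μ ν : ProbabilityMeasure ℝ) : BddBelow (levySet μ ν) :=
  ⟨0, fun _ h => h.1.le⟩

lemma levySet_mem_of_lt {μ ν : ProbabilityMeasure ℝ} {δ : ℝ} (h : levyDist μ ν < δ) :
    δ ∈ levySet μ ν := by
  have hne : (levySet μ ν).Nonempty := by
    refine ⟨1, one_pos, fun x => ⟨?_, ?_⟩⟩
    · linarith [cdf_nonneg (ν : Measure ℝ) x, cdf_le_one (μ : Measure ℝ) (x - 1)]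
    · linarith [cdf_le_one (ν : Measure ℝ) x, cdf_nonneg (μ : Measure ℝ) (x + 1)]
  obtain ⟨ε, hε, hlt⟩ := exists_lt_of_csInf_lt hne h
  refine ⟨hε.1.trans hlt, fun x => ⟨?_, ?_⟩⟩
  · have := monotone_cdf (μ : Measure ℝ) (show x - δ ≤ x - ε by linarith)
    linarith [(hε.2 x).1]
  · have := monotone_cdf (μ : Measure ℝ) (show x + ε ≤ x + δ by linarith)
    linarith [(hε.2 x).2]

lemma levyDist_le {μ ν : ProbabilityMeasure ℝ} {δ : ℝ} (h : δ ∈ levySet μ ν) :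
    levyDist μ ν ≤ δ := csInf_le (levySet_bddBelow μ ν) h

lemma levyDist_nonneg (μ ν : ProbabilityMeasure ℝ) : 0 ≤ levyDist μ ν :=
  Real.sInf_nonneg fun _ h => h.1.le

lemma levySet_symm {μ ν : ProbabilityMeasure ℝ} {δ : ℝ} (h : δ ∈ levySet μ ν) :
    δ ∈ levySet ν μ := by
  refine ⟨h.1, fun x => ⟨?_, ?_⟩⟩
  · have := (h.2 (x - δ)).2
    rw [sub_add_cancel] at this
    linarith
  · have := (h.2 (x + δ)).1
    rw [add_sub_cancel_right] at this
    linarith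

lemma levyDist_self (μ : ProbabilityMeasure ℝ) : levyDist μ μ = 0 := by
  refine le_antisymm (le_of_forall_pos_le_add fun ε hε => ?_) (levyDist_nonneg μ μ)
  rw [zero_add]
  refine levyDist_le ⟨hε, fun x => ⟨?_, ?_⟩⟩
  · linarith [monotone_cdf (μ : Measure ℝ) (show x - ε ≤ x by linarith)]
  · linarith [monotone_cdf (μ : Measure ℝ) (show x ≤ x + ε by linarith)]

lemma levyDist_comm (μ ν : ProbabilityMeasure ℝ) : levyDist μ ν = levyDist ν μ := by
  have : levySet μ ν = levySet ν μ := Set.ext fun _ => ⟨levySet_symm, levySet_symm⟩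
  rw [levyDist, levyDist, this]

lemma levyDist_triangle (μ ν ρ : ProbabilityMeasure ℝ) :
    levyDist μ ρ ≤ levyDist μ ν + levyDist ν ρ := by
  refine le_of_forall_pos_le_add fun ε hε => ?_
  obtain ⟨ha, hA⟩ := levySet_mem_of_lt (show levyDist μ ν < levyDist μ ν + ε / 2 by linarith)
  obtain ⟨hb, hB⟩ := levySet_mem_of_lt (show levyDist ν ρ < levyDist ν ρ + ε / 2 by linarith)
  refine levyDist_le ⟨by linarith, fun x => ⟨?_, ?_⟩⟩
  · have h1 := (hB x).1
    have h2 := (hA (x - (levyDist ν ρ + ε / 2))).1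
    rw [show x - (levyDist μ ν + levyDist ν ρ + ε)
      = x - (levyDist ν ρ + ε / 2) - (levyDist μ ν + ε / 2) by ring]
    linarith
  · have h1 := (hB x).2
    have h2 := (hA (x + (levyDist ν ρ + ε / 2))).2
    rw [show x + (levyDist μ ν + levyDist ν ρ + ε)
      = x + (levyDist ν ρ + ε / 2) + (levyDist μ ν + ε / 2) by ring]
    linarith

lemma cdf_le_of_levyDist_eq_zero {μ ν : ProbabilityMeasure ℝ} (h : levyDist μ ν = 0) (x : ℝ) :
    cdf (ν : Measure ℝ) x ≤ cdf (μ : Measure ℝ) x := by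
  have hc : Tendsto (cdf (μ : Measure ℝ)) (𝓝[>] x) (𝓝 (cdf (μ : Measure ℝ) x)) :=
    ((cdf (μ : Measure ℝ)).right_continuous x).tendsto.mono_left
      (nhdsWithin_mono x Set.Ioi_subset_Ici_self)
  have hs : Tendsto (fun y : ℝ => y - x) (𝓝[>] x) (𝓝 0) := by
    have : Tendsto (fun y : ℝ => y - x) (𝓝 x) (𝓝 (x - x)) := tendsto_id.sub_const x
    rw [sub_self] at this
    exact this.mono_left nhdsWithin_le_nhds
  have := hc.add hs
  rw [add_zero] at this
  refine ge_of_tendsto this ?_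
  filter_upwards [self_mem_nhdsWithin] with y hy
  have hy' : levyDist μ ν < y - x := by rw [h]; exact sub_pos.2 hy
  have := ((levySet_mem_of_lt hy').2 x).2
  rwa [add_sub_cancel] at this

lemma eq_of_levyDist_eq_zero {μ ν : ProbabilityMeasure ℝ} (h : levyDist μ ν = 0) : μ = ν := by
  apply Subtype.ext
  apply Measure.eq_of_cdf (μ : Measure ℝ) (ν : Measure ℝ)
  ext x
  exact le_antisymm (cdf_le_of_levyDist_eq_zero (levyDist_comm μ ν ▸ h) x)
    (cdf_le_of_levyDist_eq_zero h x)

/-- The space of probability distributions on `ℝ`, metrized by the Lévy metric. -/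
@[ext]
structure LevySpace where
  /-- the underlying probability distribution -/
  law : ProbabilityMeasure ℝ

instance : MetricSpace LevySpace where
  dist μ ν := levyDist μ.law ν.law
  dist_self μ := levyDist_self μ.law
  dist_comm μ ν := levyDist_comm μ.law ν.law
  dist_triangle μ ν ρ := levyDist_triangle μ.law ν.law ρ.law
  eq_of_dist_eq_zero h := LevySpace.ext (eq_of_levyDist_eq_zero h)

/-! ### Sums of independent uniform random variables -/

/-- The continuous uniform distribution `U[a, b]`, for `a ≤ b`. When `a = b` it is the point mass
at `a` (this is also the value in the irrelevant case `b < a`). -/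
def uniformLaw (a b : ℝ) : Measure ℝ :=
  if a < b then ProbabilityTheory.cond volume (Set.Icc a b) else Measure.dirac a

instance (a b : ℝ) : IsProbabilityMeasure (uniformLaw a b) := by
  unfold uniformLaw
  split_ifs with h
  · exact cond_isProbabilityMeasure_of_finite (by simp [h]) (by simp)
  · infer_instance

/-- The joint law on `ℝ^ℕ` of independent random variables `X_k`, `k ∈ ℕ`, where `X_k` has the
uniform distribution `U[-t_k/2, t_k/2]`. -/
def uniformSeqLaw (t : ℕ → ℝ) : Measure (ℕ → ℝ) :=
  Measure.infinitePi fun k => uniformLaw (-(t k) / 2) (t k / 2)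

instance (t : ℕ → ℝ) : IsProbabilityMeasure (uniformSeqLaw t) := by
  unfold uniformSeqLaw
  infer_instance

/-- The sum `lim_n (x_0 + ⋯ + x_{n-1})` of the series with terms `x_k`
(an arbitrary value when the series diverges). -/
def seriesSum (x : ℕ → ℝ) : ℝ := limUnder atTop fun n => ∑ k ∈ Finset.range n, x k

lemma measurable_seriesSum : Measurable seriesSum := by
  have h : ∀ n : ℕ, StronglyMeasurable fun x : ℕ → ℝ => ∑ k ∈ Finset.range n, x k := fun n =>
    (Finset.measurable_fun_sum _ fun k _ => measurable_pi_apply k).stronglyMeasurable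
  exact (StronglyMeasurable.limUnder (l := atTop) h).measurable

/-- The law of the uniform sum random variable `S_t = U[-t_0/2, t_0/2] + U[-t_1/2, t_1/2] + ⋯`,
the sum of a series of independent random variables. -/
def uniformSumLaw (t : ℕ → ℝ) : Measure ℝ := (uniformSeqLaw t).map seriesSum

instance (t : ℕ → ℝ) : IsProbabilityMeasure (uniformSumLaw t) :=
  Measure.isProbabilityMeasure_map measurable_seriesSum.aemeasurable

lemma ae_mem_uniformLaw {t : ℝ} (ht : 0 ≤ t) :
    ∀ᵐ x ∂(uniformLaw (-t / 2) (t / 2)), x ∈ Set.Icc (-t / 2) (t / 2) := by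
  unfold uniformLaw
  split_ifs with h
  · exact ae_cond_mem measurableSet_Icc
  · refine (ae_dirac_iff (p := fun x => x ∈ Set.Icc (-t / 2) (t / 2)) measurableSet_Icc).2 ?_
    constructor <;> linarith

lemma integral_uniformLaw {t : ℝ} (ht : 0 ≤ t) :
    ∫ x, x ∂(uniformLaw (-t / 2) (t / 2)) = 0 := by
  unfold uniformLaw
  split_ifs with h
  · rw [ProbabilityTheory.cond, integral_smul_measure, integral_Icc_eq_integral_Ioc,
      ← intervalIntegral.integral_of_le h.le, integral_id]
    simp only [smul_eq_mul]
    ring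
  · rw [integral_dirac]
    linarith

/-- The series defining `S_t` converges almost surely for square-summable `t`. -/
theorem ae_tendsto_seriesSum {t : ℕ → ℝ} (h0 : ∀ k, 0 ≤ t k) (hs : Summable fun k => t k ^ 2) :
    ∀ᵐ x ∂(uniformSeqLaw t),
      Tendsto (fun n => ∑ k ∈ Finset.range n, x k) atTop (𝓝 (seriesSum x)) := by
  set P := uniformSeqLaw t with hP
  let X : ℕ → (ℕ → ℝ) → ℝ := fun k x => x k
  have hX : ∀ k, StronglyMeasurable (X k) := fun k => (measurable_pi_apply k).stronglyMeasurable
  have hpres : ∀ k, MeasurePreserving (X k) P (uniformLaw (-(t k) / 2) (t k / 2)) := fun k =>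
    measurePreserving_eval_infinitePi (fun k => uniformLaw (-(t k) / 2) (t k / 2)) k
  have hind : iIndepFun X P := iIndepFun_infinitePi
    (P := fun k => uniformLaw (-(t k) / 2) (t k / 2)) (X := fun _ x => x) (fun _ => measurable_id)
  have hbd : ∀ k, ∀ᵐ x ∂P, X k x ∈ Set.Icc (-(t k) / 2) (t k / 2) := fun k =>
    (hpres k).quasiMeasurePreserving.ae (ae_mem_uniformLaw (h0 k))
  have hLp : ∀ k, MemLp (X k) 2 P := fun k =>
    memLp_of_bounded (hbd k) (hX k).aestronglyMeasurable 2
  have hmean : ∀ k, ∫ x, X k x ∂P = 0 := fun k => by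
    have := integral_map (hpres k).aemeasurable (f := fun y : ℝ => y)
      (by rw [(hpres k).map_eq]; exact measurable_id.aestronglyMeasurable)
    rw [(hpres k).map_eq, integral_uniformLaw (h0 k)] at this
    exact this.symm
  let F : ℕ → (ℕ → ℝ) → ℝ := fun n => ∑ k ∈ Finset.range (n + 1), X k
  have hFLp : ∀ n, MemLp (F n) 2 P := fun n => memLp_finsetSum' _ fun k _ => hLp k
  have hmart : Martingale F (Filtration.natural X hX) P := by
    refine martingale_of_condExp_sub_eq_zero_nat (fun n => ?_)
      (fun n => (hFLp n).integrable (by norm_num)) (fun n => ?_)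
    · refine Finset.stronglyMeasurable_sum _ fun k hk => ?_
      exact ((Filtration.stronglyAdapted_natural hX) k).mono
        ((Filtration.natural X hX).mono (Nat.lt_succ_iff.1 (Finset.mem_range.1 hk)))
    · have : F (n + 1) - F n = X (n + 1) := by
        simp only [F]
        rw [Finset.sum_range_succ, add_sub_cancel_left]
      rw [this]
      refine (hind.condExp_natural_ae_eq_of_lt hX (Nat.lt_succ_self n)).trans ?_
      rw [hmean]
      rfl
  have hsq : ∀ n, ∫ x, F n x ^ 2 ∂P ≤ ∑' k, t k ^ 2 := fun n => by
    have hF0 : ∫ x, F n x ∂P = 0 := by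
      simp only [F, Finset.sum_apply]
      rw [integral_finsetSum _ fun k _ => (hLp k).integrable (by norm_num)]
      exact Finset.sum_eq_zero fun k _ => hmean k
    rw [← variance_of_integral_eq_zero (hFLp n).aemeasurable hF0,
      IndepFun.variance_sum (fun k _ => hLp k) (fun i _ j _ hij => hind.indepFun hij)]
    refine (Finset.sum_le_sum fun k _ => ?_).trans (hs.sum_le_tsum _ fun k _ => sq_nonneg _)
    refine (variance_le_sq_of_bounded (hbd k) (hX k).measurable.aemeasurable).trans ?_
    nlinarith [sq_nonneg (t k)]
  have hbdd : ∀ n, eLpNorm (F n) 1 P ≤ (Real.toNNReal (1 + ∑' k, t k ^ 2) : NNReal) := fun n => by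
    have hi : Integrable (F n) P := (hFLp n).integrable (by norm_num)
    rw [eLpNorm_one_eq_lintegral_enorm, ← ofReal_integral_norm_eq_lintegral_enorm hi]
    refine ENNReal.ofReal_le_ofReal ?_
    calc ∫ x, ‖F n x‖ ∂P ≤ ∫ x, (1 + F n x ^ 2) ∂P := by
          refine integral_mono hi.norm ((integrable_const 1).add (hFLp n).integrable_sq) fun x => ?_
          have := sq_nonneg (|F n x| - 1)
          simp only [Real.norm_eq_abs]
          nlinarith [sq_abs (F n x), abs_nonneg (F n x)]
      _ = 1 + ∫ x, F n x ^ 2 ∂P := by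
          rw [integral_add (integrable_const 1) (hFLp n).integrable_sq]
          simp
      _ ≤ _ := by linarith [hsq n]
  filter_upwards [hmart.submartingale.exists_ae_tendsto_of_bdd hbdd] with x hx
  refine tendsto_nhds_limUnder ?_
  obtain ⟨c, hc⟩ := hx
  refine ⟨c, (tendsto_add_atTop_iff_nat 1).1 ?_⟩
  simpa only [F, Finset.sum_apply] using hc

/-! ### DUSTPAN distributions -/

/-- The distribution of `S_t + N(0, σ²)`, the two summands being independent
(`∗` is convolution of measures). -/
def dustpan (t : ℕ → ℝ) (σ : ℝ) : LevySpace :=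
  ⟨⟨uniformSumLaw t ∗ gaussianReal 0 (Real.toNNReal (σ ^ 2)), inferInstance⟩⟩

/-- The set of weakly decreasing sequences of nonnegative reals with finite `2`-norm. -/
def decrL2 : Set (ℕ → ℝ) :=
  {t | Antitone t ∧ (∀ k, 0 ≤ t k) ∧ Summable fun k => t k ^ 2}

/-- The `2`-norm of a square-summable sequence. -/
def norm2 (t : ℕ → ℝ) : ℝ := Real.sqrt (∑' k, t k ^ 2)

/-- The standardized parameter space. As a subtype of `ℕ → ℝ` it carries the topology of pointwise
convergence. -/
def dustpanParam : Set (ℕ → ℝ) := {t | t ∈ decrL2 ∧ norm2 t ^ 2 ≤ 12}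

/-- The moduli space of standardized DUSTPAN distributions, with the Lévy metric. -/
def dustpanModuli : Set LevySpace :=
  {μ | ∃ t ∈ decrL2, ∃ σ : ℝ, 0 ≤ σ ∧ norm2 t ^ 2 / 12 + σ ^ 2 = 1 ∧ μ = dustpan t σ}

end

/-! ### Weak convergence implies convergence in the Lévy metric -/

/-! A continuous bijection from a compact space onto a Hausdorff space is a homeomorphism, so no
continuity of the inverse has to be proved. The parameter space is a closed subset of a cube
(`isCompact_dustpanParam`). Continuity is delicate because `norm2` is not continuous for pointwise
convergence: mass spread over many small terms disappears in the limit and must become Gaussian.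
Write `sinc u = exp (-u² / 6) * (1 + sincDefect u)`. In the characteristic function the exponentials
combine with the normal factor into `exp (-x² / 2)`, free of `t` (`charFun_stdDustpan`). The defects
are O(u⁴) and `t k ^ 2 ≤ 12 / (k + 1)`, so the remaining product has a uniform summable majorant and
dominated convergence applies (`continuous_stdDustpan`). For injectivity, the first positive zero of
the characteristic function is `2π / t 0`; this recovers `t 0`, whose sinc factor is cancelled
before iterating (`eq_of_dustpan_eq`). -/

lemma levyDist_le_levyProkhorovDist (μ ν : ProbabilityMeasure ℝ) :
    levyDist μ ν ≤ levyProkhorovDist (μ : Measure ℝ) (ν : Measure ℝ) := by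
  have key : ∀ (μ ν : ProbabilityMeasure ℝ) (δ : ℝ), 0 < δ →
      levyProkhorovEDist (μ : Measure ℝ) (ν : Measure ℝ) < ENNReal.ofReal δ → ∀ x : ℝ,
        cdf (μ : Measure ℝ) x ≤ cdf (ν : Measure ℝ) (x + δ) + δ := by
    intro μ ν δ hδ h x
    have h1 := left_measure_le_of_levyProkhorovEDist_lt h (measurableSet_Iic (a := x))
    rw [ENNReal.toReal_ofReal hδ.le] at h1
    have hsub : Metric.thickening δ (Set.Iic x) ⊆ Set.Iic (x + δ) := by
      intro y hy
      obtain ⟨z, hz, hyz⟩ := Metric.mem_thickening_iff.1 hy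
      rw [Real.dist_eq] at hyz
      have := (abs_lt.1 hyz).2
      simp only [Set.mem_Iic] at hz ⊢
      linarith
    have h2 := h1.trans (add_le_add_left (measure_mono hsub) _)
    rw [← ofReal_cdf, ← ofReal_cdf, ← ENNReal.ofReal_add (cdf_nonneg _ _) hδ.le] at h2
    exact (ENNReal.ofReal_le_ofReal_iff (add_nonneg (cdf_nonneg _ _) hδ.le)).1 h2
  refine le_of_forall_pos_le_add fun ε hε => ?_
  set δ := levyProkhorovDist (μ : Measure ℝ) (ν : Measure ℝ) + ε with hδ
  have hpos : 0 < δ := add_pos_of_nonneg_of_pos ENNReal.toReal_nonneg hε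
  have hlt : levyProkhorovEDist (μ : Measure ℝ) (ν : Measure ℝ) < ENNReal.ofReal δ := by
    rw [← ENNReal.ofReal_toReal (levyProkhorovEDist_ne_top (μ : Measure ℝ) (ν : Measure ℝ))]
    exact (ENNReal.ofReal_lt_ofReal_iff hpos).2 (lt_add_of_pos_right _ hε)
  refine levyDist_le ⟨hpos, fun x => ⟨?_, ?_⟩⟩
  · have := key μ ν δ hpos hlt (x - δ)
    rw [sub_add_cancel] at this
    linarith
  · exact key ν μ δ hpos (by rwa [levyProkhorovEDist_comm]) x

/-- The Lévy–Prokhorov metric induces weak convergence and dominates the Lévy metric, which tests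
only half-lines. -/
lemma continuous_levySpace_mk : Continuous LevySpace.mk := by
  have h : LipschitzWith 1
      fun μ : LevyProkhorov (ProbabilityMeasure ℝ) => LevySpace.mk μ.toMeasure :=
    LipschitzWith.of_dist_le_mul fun μ ν => by
      rw [NNReal.coe_one, one_mul]
      exact levyDist_le_levyProkhorovDist _ _
  exact h.continuous.comp LevyProkhorov.continuous_ofMeasure_probabilityMeasure

/-! ### The characteristic function of a sum of independent uniform random variables -/

lemma charFun_uniformLaw {t : ℝ} (ht : 0 ≤ t) (x : ℝ) :
    charFun (uniformLaw (-t / 2) (t / 2)) x = (Real.sinc (t * x / 2) : ℂ) := by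
  rcases ht.eq_or_lt with rfl | ht
  · simp [uniformLaw, charFun_dirac]
  rcases eq_or_ne x 0 with rfl | hx
  · simp
  have hlt : -t / 2 < t / 2 := by linarith
  rw [uniformLaw, if_pos hlt, charFun_apply_real, ProbabilityTheory.cond, integral_smul_measure,
    integral_Icc_eq_integral_Ioc, ← intervalIntegral.integral_of_le hlt.le]
  have h := intervalIntegral.integral_comp_mul_left (a := -t / 2) (b := t / 2)
    (fun y : ℝ => Complex.exp (y * Complex.I)) hx
  rw [show x * (-t / 2) = -(t * x / 2) by ring, show x * (t / 2) = t * x / 2 by ring,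
    integral_exp_mul_I_eq_sinc] at h
  push_cast at h
  rw [h, Real.volume_Icc, show t / 2 - -t / 2 = t by ring, ENNReal.toReal_inv,
    ENNReal.toReal_ofReal ht.le, Complex.real_smul, Complex.real_smul]
  have hx' : (x : ℂ) ≠ 0 := mod_cast hx
  have ht' : (t : ℂ) ≠ 0 := mod_cast ht.ne'
  push_cast
  field_simp

lemma tendsto_charFun_of_ae_tendsto {Ω : Type*} [MeasurableSpace Ω] {P : Measure Ω}
    [IsProbabilityMeasure P] {S : ℕ → Ω → ℝ} {T : Ω → ℝ} (hS : ∀ n, Measurable (S n))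
    (hT : Measurable T) (h : ∀ᵐ ω ∂P, Tendsto (fun n => S n ω) atTop (𝓝 (T ω))) (x : ℝ) :
    Tendsto (fun n => charFun (P.map (S n)) x) atTop (𝓝 (charFun (P.map T) x)) := by
  have hmap : ∀ f : Ω → ℝ, Measurable f →
      charFun (P.map f) x = ∫ ω, Complex.exp (x * f ω * Complex.I) ∂P := fun f hf => by
    rw [charFun_apply_real, integral_map hf.aemeasurable (by fun_prop)]
  rw [hmap T hT]
  simp_rw [fun n => hmap (S n) (hS n)]
  refine tendsto_integral_of_dominated_convergence (fun _ => 1) (fun n => ?_)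
    (integrable_const 1) (fun n => ?_) ?_
  · have := hS n
    exact Measurable.aestronglyMeasurable (by fun_prop)
  · refine ae_of_all _ fun ω => ?_
    rw [← Complex.ofReal_mul, Complex.norm_exp_ofReal_mul_I]
  · filter_upwards [h] with ω hω
    have hc : Continuous fun y : ℝ => Complex.exp (x * y * Complex.I) := by fun_prop
    exact (hc.tendsto (T ω)).comp hω

lemma tendsto_prod_sinc_charFun {t : ℕ → ℝ} (ht : t ∈ decrL2) (x : ℝ) :
    Tendsto (fun n => ((∏ k ∈ Finset.range n, Real.sinc (t k * x / 2) : ℝ) : ℂ)) atTop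
      (𝓝 (charFun (uniformSumLaw t) x)) := by
  have hind : iIndepFun (fun (k : ℕ) (y : ℕ → ℝ) => y k) (uniformSeqLaw t) := iIndepFun_infinitePi
    (P := fun k => uniformLaw (-(t k) / 2) (t k / 2)) (X := fun _ x => x) (fun _ => measurable_id)
  have hmarg : ∀ k, (uniformSeqLaw t).map (fun y => y k) = uniformLaw (-(t k) / 2) (t k / 2) :=
    fun k => (measurePreserving_eval_infinitePi
      (fun k => uniformLaw (-(t k) / 2) (t k / 2)) k).map_eq
  refine (tendsto_charFun_of_ae_tendsto
    (fun n => Finset.measurable_fun_sum _ fun k _ => measurable_pi_apply k)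
    measurable_seriesSum (ae_tendsto_seriesSum ht.2.1 ht.2.2) x).congr fun n => ?_
  rw [iIndepFun.charFun_map_fun_finsetSum_eq_prod
    (fun k _ => (measurable_pi_apply k).aemeasurable) (hind.restrict _), Finset.prod_apply]
  simp_rw [hmarg, fun k => charFun_uniformLaw (ht.2.1 k)]
  push_cast
  rfl

/-! ### Convergence of the infinite product -/

/-- The deviation of `sinc u` from `exp (-u² / 6)`, in relative form. -/
noncomputable def sincDefect (u : ℝ) : ℝ := Real.sinc u * Real.exp (u ^ 2 / 6) - 1

lemma continuous_sincDefect : Continuous sincDefect := by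
  unfold sincDefect
  have := Real.continuous_sinc
  fun_prop

lemma abs_sinc_sub_le {u : ℝ} (hu : |u| ≤ 1) : |Real.sinc u - (1 - u ^ 2 / 6)| ≤ u ^ 4 / 100 := by
  rcases eq_or_ne u 0 with rfl | h0
  · simp
  have hpos : 0 < |u| := abs_pos.2 h0
  have h := Real.sin_bound hu
  rw [show Real.sin u - (u - u ^ 3 / 6) = u * (Real.sinc u - (1 - u ^ 2 / 6)) by
    rw [Real.sinc_of_ne_zero h0]; field_simp, abs_mul] at h
  refine le_of_mul_le_mul_left (h.trans_eq ?_) hpos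
  rw [← Even.pow_abs (n := 4) (by decide) u]
  ring

/-- The exponent `u² / 6` cancels the quadratic term of `sinc`: `(1 - u²/6)(1 + u²/6) = 1 - u⁴/36`.
For `|u| > 1` the trivial bound suffices, since `u⁴ ≥ 1`. -/
lemma abs_sincDefect_le (u : ℝ) :
    |sincDefect u| ≤ (1 + Real.exp (u ^ 2 / 6)) * u ^ 4 := by
  have hE := Real.exp_pos (u ^ 2 / 6)
  unfold sincDefect
  rcases le_or_gt |u| 1 with hu | hu
  · have hu2 : u ^ 2 ≤ 1 := (sq_le_one_iff_abs_le_one u).2 hu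
    have hy : |u ^ 2 / 6| ≤ 1 := by rw [abs_of_nonneg (by positivity)]; linarith
    have hq := Real.abs_exp_sub_one_sub_id_le hy
    have hr := abs_sinc_sub_le hu
    set E := Real.exp (u ^ 2 / 6)
    have h4 : 0 ≤ u ^ 4 := by positivity
    calc |Real.sinc u * E - 1|
        = |(Real.sinc u - (1 - u ^ 2 / 6)) * E + (1 - u ^ 2 / 6) * (E - 1 - u ^ 2 / 6)
            - u ^ 4 / 36| := by ring_nf
      _ ≤ |(Real.sinc u - (1 - u ^ 2 / 6)) * E| + |(1 - u ^ 2 / 6) * (E - 1 - u ^ 2 / 6)|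
            + |u ^ 4 / 36| := (abs_sub _ _).trans (add_le_add_left (abs_add_le _ _) _)
      _ ≤ u ^ 4 / 100 * E + 1 * (u ^ 2 / 6) ^ 2 + u ^ 4 / 36 := by
          rw [abs_mul, abs_mul, abs_of_pos hE, abs_of_nonneg (by positivity : 0 ≤ u ^ 4 / 36)]
          gcongr
          rw [abs_le]
          constructor <;> nlinarith [sq_nonneg u]
      _ ≤ (1 + E) * u ^ 4 := by nlinarith [mul_nonneg h4 hE.le]
  · have h4 : 1 ≤ u ^ 4 := by
      rw [← Even.pow_abs (n := 4) (by decide) u]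
      exact one_le_pow₀ hu.le
    calc |Real.sinc u * Real.exp (u ^ 2 / 6) - 1|
        ≤ |Real.sinc u * Real.exp (u ^ 2 / 6)| + |1| := abs_sub _ _
      _ ≤ 1 * Real.exp (u ^ 2 / 6) + 1 := by
          rw [abs_mul, abs_one, abs_of_pos hE]
          gcongr
          exact Real.abs_sinc_le_one u
      _ ≤ (1 + Real.exp (u ^ 2 / 6)) * u ^ 4 := by nlinarith

lemma norm2_sq (t : ℕ → ℝ) : norm2 t ^ 2 = ∑' k, t k ^ 2 :=
  Real.sq_sqrt (tsum_nonneg fun _ => sq_nonneg _)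

/-- By monotonicity the first `k + 1` squares are all at least `t k ^ 2`. Fourth powers are then
O(1/(k+1)²), uniformly in `t`. -/
lemma sq_le_norm2_sq_div {t : ℕ → ℝ} (ht : t ∈ decrL2) (k : ℕ) :
    t k ^ 2 ≤ norm2 t ^ 2 / (k + 1) := by
  rw [le_div_iff₀ (by positivity), norm2_sq]
  calc t k ^ 2 * (k + 1) = ∑ j ∈ Finset.range (k + 1), t k ^ 2 := by
        rw [Finset.sum_const, Finset.card_range, nsmul_eq_mul]; push_cast; ring
    _ ≤ ∑ j ∈ Finset.range (k + 1), t j ^ 2 := Finset.sum_le_sum fun j hj =>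
        pow_le_pow_left₀ (ht.2.1 k) (ht.1 (Nat.lt_succ_iff.1 (Finset.mem_range.1 hj))) 2
    _ ≤ ∑' j, t j ^ 2 := ht.2.2.sum_le_tsum _ fun j _ => sq_nonneg _

/-- A summable majorant of the deviations `sincDefect (t k * x / 2)`, uniform over the decreasing
sequences `t` with `|t|² ≤ B`. -/
noncomputable def sincDefectBound (B x : ℝ) (k : ℕ) : ℝ :=
  (1 + Real.exp (B * x ^ 2 / 24)) * (B ^ 2 * x ^ 4 / 16) * (1 / ((k : ℝ) + 1) ^ 2)

lemma summable_sincDefectBound (B x : ℝ) : Summable (sincDefectBound B x) := by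
  refine Summable.mul_left _ ?_
  have := (summable_nat_add_iff 1).2 (Real.summable_one_div_nat_pow.2 one_lt_two)
  simpa using this

lemma abs_sincDefect_le_bound {t : ℕ → ℝ} (ht : t ∈ decrL2) {B : ℝ} (hB : norm2 t ^ 2 ≤ B)
    (x : ℝ) (k : ℕ) : ‖sincDefect (t k * x / 2)‖ ≤ sincDefectBound B x k := by
  have hk : (0 : ℝ) < k + 1 := by positivity
  have hB0 : 0 ≤ B := (sq_nonneg _).trans hB
  have h1 : t k ^ 2 ≤ B / (k + 1) := (sq_le_norm2_sq_div ht k).trans (by gcongr)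
  have h2 : t k ^ 2 ≤ B := h1.trans (div_le_self hB0 (by linarith [Nat.cast_nonneg (α := ℝ) k]))
  refine (abs_sincDefect_le _).trans ?_
  rw [sincDefectBound, mul_assoc]
  have h3 : (t k * x / 2) ^ 2 / 6 ≤ B * x ^ 2 / 24 := by
    rw [show (t k * x / 2) ^ 2 / 6 = t k ^ 2 * x ^ 2 / 24 by ring]
    gcongr
  have h4 : (t k * x / 2) ^ 4 ≤ B ^ 2 * x ^ 4 / 16 * (1 / ((k : ℝ) + 1) ^ 2) := by
    rw [show (t k * x / 2) ^ 4 = (t k ^ 2) ^ 2 * (x ^ 4 / 16) by ring,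
      show B ^ 2 * x ^ 4 / 16 * (1 / ((k : ℝ) + 1) ^ 2) = (B / (k + 1)) ^ 2 * (x ^ 4 / 16) by
        field_simp]
    gcongr
  gcongr

lemma summable_norm_sincDefect {t : ℕ → ℝ} (ht : t ∈ decrL2) (x : ℝ) :
    Summable fun k => ‖sincDefect (t k * x / 2)‖ :=
  (summable_sincDefectBound _ x).of_nonneg_of_le (fun _ => norm_nonneg _)
    (abs_sincDefect_le_bound ht le_rfl x)

lemma charFun_uniformSumLaw {t : ℕ → ℝ} (ht : t ∈ decrL2) (x : ℝ) :
    charFun (uniformSumLaw t) x = (((∏' k, (1 + sincDefect (t k * x / 2))) *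
      Real.exp (-(norm2 t ^ 2 * x ^ 2 / 24)) : ℝ) : ℂ) := by
  refine tendsto_nhds_unique (tendsto_prod_sinc_charFun ht x)
    ((Complex.continuous_ofReal.tendsto _).comp ?_)
  have h1 := (multipliable_one_add_of_summable
    (summable_norm_sincDefect ht x)).hasProd.tendsto_prod_nat
  have h2 := (ht.2.2.hasSum.tendsto_sum_nat.mul_const (x ^ 2 / 24)).neg
  have h3 := h1.mul ((Real.continuous_exp.tendsto _).comp h2)
  rw [← norm2_sq, ← mul_div_assoc] at h3
  -- With `u = t k * x / 2`, the factor `exp (-u² / 6)` is `exp (-(t k)² x² / 24)`; the identity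
  -- holds already for partial products.
  refine h3.congr fun n => ?_
  rw [Function.comp_apply, Finset.sum_mul, ← Finset.sum_neg_distrib, Real.exp_sum,
    ← Finset.prod_mul_distrib]
  refine Finset.prod_congr rfl fun k _ => ?_
  rw [sincDefect, add_sub_cancel, mul_assoc, ← Real.exp_add]
  ring_nf
  simp

/-! ### Compactness of the parameter space and continuity -/

/-- Partial sums involve finitely many coordinates, so each condition is closed for pointwise
convergence. -/
lemma mem_dustpanParam_iff {t : ℕ → ℝ} :
    t ∈ dustpanParam ↔
      Antitone t ∧ (∀ k, 0 ≤ t k) ∧ ∀ n, ∑ k ∈ Finset.range n, t k ^ 2 ≤ 12 := by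
  constructor
  · rintro ⟨⟨h1, h2, h3⟩, h4⟩
    rw [norm2_sq] at h4
    exact ⟨h1, h2, fun n => (h3.sum_le_tsum _ fun _ _ => sq_nonneg _).trans h4⟩
  · rintro ⟨h1, h2, h3⟩
    refine ⟨⟨h1, h2, summable_of_sum_range_le (fun _ => sq_nonneg _) h3⟩, ?_⟩
    rw [norm2_sq]
    exact Real.tsum_le_of_sum_range_le (fun _ => sq_nonneg _) h3

lemma isCompact_dustpanParam : IsCompact dustpanParam := by
  have hcl : IsClosed dustpanParam := by
    have : dustpanParam = {t | Antitone t} ∩ ((⋂ k, {t | 0 ≤ t k}) ∩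
        ⋂ n, {t | ∑ k ∈ Finset.range n, t k ^ 2 ≤ 12}) := by
      ext t
      simp [mem_dustpanParam_iff]
    rw [this]
    refine isClosed_antitone.inter ((isClosed_iInter fun k => ?_).inter
      (isClosed_iInter fun n => ?_))
    · exact isClosed_le continuous_const (by fun_prop)
    · exact isClosed_le (by fun_prop) continuous_const
  -- Any bound with square at least 12 would do.
  refine (isCompact_univ_pi fun _ : ℕ => isCompact_Icc (a := (0 : ℝ)) (b := 4)).of_isClosed_subset
    hcl fun t ht k _ => ?_
  have h := mem_dustpanParam_iff.1 ht
  refine ⟨h.2.1 k, ?_⟩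
  have hk : t k ^ 2 ≤ 12 := (Finset.single_le_sum (f := fun j => t j ^ 2)
    (fun j _ => sq_nonneg _) (Finset.self_mem_range_succ k)).trans (h.2.2 (k + 1))
  nlinarith [h.2.1 k]

/-- The standardized DUSTPAN distribution with parameter `t`. -/
noncomputable def stdDustpan (t : ℕ → ℝ) : LevySpace :=
  dustpan t (Real.sqrt (1 - norm2 t ^ 2 / 12))

lemma charFun_dustpan (t : ℕ → ℝ) (σ x : ℝ) :
    charFun ((dustpan t σ).law : Measure ℝ) x =
      charFun (uniformSumLaw t) x * ((Real.exp (-(σ ^ 2 * x ^ 2 / 2)) : ℝ) : ℂ) := by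
  change charFun (uniformSumLaw t ∗ gaussianReal 0 (Real.toNNReal (σ ^ 2))) x = _
  rw [charFun_conv, charFun_gaussianReal, Real.coe_toNNReal _ (sq_nonneg σ)]
  push_cast
  ring_nf

lemma charFun_stdDustpan {t : ℕ → ℝ} (ht : t ∈ dustpanParam) (x : ℝ) :
    charFun ((stdDustpan t).law : Measure ℝ) x =
      (((∏' k, (1 + sincDefect (t k * x / 2))) * Real.exp (-(x ^ 2 / 2)) : ℝ) : ℂ) := by
  rw [stdDustpan, charFun_dustpan, charFun_uniformSumLaw ht.1,
    Real.sq_sqrt (by linarith [ht.2]), ← Complex.ofReal_mul, mul_assoc, ← Real.exp_add]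
  congr 3
  ring

lemma continuous_stdDustpan : Continuous fun t : dustpanParam => stdDustpan t := by
  refine continuous_levySpace_mk.comp (g := LevySpace.mk)
    (f := fun t : dustpanParam => (stdDustpan t).law) ?_
  -- Sequences suffice, and they are what Lévy's continuity theorem for characteristic functions
  -- needs.
  rw [continuous_iff_seqContinuous]
  intro u t hu
  refine ProbabilityMeasure.tendsto_of_tendsto_charFun fun x => ?_
  simp only [Function.comp_apply, charFun_stdDustpan (Subtype.coe_prop _)]
  refine (Complex.continuous_ofReal.tendsto _).comp (Tendsto.mul_const _ ?_)
  refine tendsto_tprod_one_add_of_dominated_convergence (summable_sincDefectBound 12 x)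
    (fun k => ?_) (Eventually.of_forall fun n k =>
      abs_sincDefect_le_bound (u n).2.1 (u n).2.2 x k)
  have hc : Continuous fun t : dustpanParam => sincDefect ((t : ℕ → ℝ) k * x / 2) :=
    continuous_sincDefect.comp
      ((((continuous_apply (A := fun _ : ℕ => ℝ) k).comp
        continuous_subtype_val).mul_const x).div_const 2)
  exact (hc.tendsto t).comp hu

/-! ### Recovering the parameter from the characteristic function -/

lemma decrL2_shift {t : ℕ → ℝ} (ht : t ∈ decrL2) : (fun k => t (k + 1)) ∈ decrL2 :=
  ⟨fun _ _ h => ht.1 (Nat.succ_le_succ h), fun k => ht.2.1 (k + 1),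
    (summable_nat_add_iff 1).2 ht.2.2⟩

lemma charFun_uniformSumLaw_eq_sinc_mul {t : ℕ → ℝ} (ht : t ∈ decrL2) (x : ℝ) :
    charFun (uniformSumLaw t) x =
      (Real.sinc (t 0 * x / 2) : ℂ) * charFun (uniformSumLaw fun k => t (k + 1)) x := by
  refine tendsto_nhds_unique ((tendsto_add_atTop_iff_nat 1).2 (tendsto_prod_sinc_charFun ht x))
    (((tendsto_prod_sinc_charFun (decrL2_shift ht) x).const_mul _).congr fun n => ?_)
  rw [Finset.prod_range_succ']
  push_cast
  ring

lemma charFun_dustpan_eq_sinc_mul {t : ℕ → ℝ} (ht : t ∈ decrL2) (σ x : ℝ) :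
    charFun ((dustpan t σ).law : Measure ℝ) x = (Real.sinc (t 0 * x / 2) : ℂ) *
      charFun ((dustpan (fun k => t (k + 1)) σ).law : Measure ℝ) x := by
  rw [charFun_dustpan, charFun_dustpan, charFun_uniformSumLaw_eq_sinc_mul ht, mul_assoc]

lemma sinc_ne_zero_of_abs_lt_pi {u : ℝ} (hu : |u| < Real.pi) : Real.sinc u ≠ 0 := by
  rcases eq_or_ne u 0 with rfl | h0
  · simp
  rw [Real.sinc_of_ne_zero h0]
  refine div_ne_zero (fun h => h0 ?_) h0
  obtain ⟨h1, h2⟩ := abs_lt.1 hu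
  exact (Real.sin_eq_zero_iff_of_lt_of_lt h1 h2).1 h

/-- Every `t k * x / 2` stays below π because `t 0` is the largest width, and a product of nonzero
factors with summable defects does not vanish. -/
lemma charFun_dustpan_ne_zero {t : ℕ → ℝ} (ht : t ∈ decrL2) (σ : ℝ) {x : ℝ} (hx : 0 ≤ x)
    (h : t 0 * x < 2 * Real.pi) : charFun ((dustpan t σ).law : Measure ℝ) x ≠ 0 := by
  rw [charFun_dustpan, charFun_uniformSumLaw ht]
  refine mul_ne_zero ?_ (Complex.ofReal_ne_zero.2 (Real.exp_pos _).ne')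
  refine Complex.ofReal_ne_zero.2 (mul_ne_zero ?_ (Real.exp_pos _).ne')
  refine tprod_one_add_ne_zero_of_summable (fun k => ?_) (summable_norm_sincDefect ht x)
  rw [sincDefect, add_sub_cancel]
  refine mul_ne_zero (sinc_ne_zero_of_abs_lt_pi ?_) (Real.exp_pos _).ne'
  have h0 := ht.2.1 k
  rw [abs_of_nonneg (by positivity)]
  nlinarith [mul_le_mul_of_nonneg_right (ht.1 (Nat.zero_le k)) hx]

lemma charFun_dustpan_eq_zero {t : ℕ → ℝ} (ht : t ∈ decrL2) (σ : ℝ) (h : 0 < t 0) :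
    charFun ((dustpan t σ).law : Measure ℝ) (2 * Real.pi / t 0) = 0 := by
  rw [charFun_dustpan_eq_sinc_mul ht, show t 0 * (2 * Real.pi / t 0) / 2 = Real.pi by field_simp,
    Real.sinc_of_ne_zero Real.pi_ne_zero, Real.sin_pi, zero_div, Complex.ofReal_zero, zero_mul]

lemma le_zero_of_dustpan_eq {t s : ℕ → ℝ} (ht : t ∈ decrL2) (hs : s ∈ decrL2) {σ τ : ℝ}
    (h : dustpan t σ = dustpan s τ) : s 0 ≤ t 0 := by
  by_contra! hlt
  have hpos : 0 < s 0 := (ht.2.1 0).trans_lt hlt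
  -- This zero for `s` would precede every positive zero for `t`.
  refine charFun_dustpan_ne_zero ht σ (x := 2 * Real.pi / s 0) (by positivity) ?_ ?_
  · rw [← mul_div_assoc, div_lt_iff₀ hpos, mul_comm]
    gcongr
  · rw [h, charFun_dustpan_eq_zero hs τ hpos]

lemma dense_sinc_ne_zero (a : ℝ) : Dense {x : ℝ | Real.sinc (a * x / 2) ≠ 0} := by
  rcases eq_or_ne a 0 with rfl | ha
  · simp
  have hsub : {x : ℝ | Real.sinc (a * x / 2) ≠ 0}ᶜ ⊆ Set.range fun n : ℤ => 2 * (n * Real.pi) / a := by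
    intro x hx
    simp only [Set.mem_compl_iff, Set.mem_ofPred_eq, not_not] at hx
    have h0 : a * x / 2 ≠ 0 := fun h => by simp [h] at hx
    rw [Real.sinc_of_ne_zero h0, div_eq_zero_iff, or_iff_left h0] at hx
    obtain ⟨n, hn⟩ := Real.sin_eq_zero_iff.1 hx
    refine ⟨n, ?_⟩
    simp only [hn]
    field_simp
  have := ((Set.countable_range _).mono hsub).dense_compl ℝ
  rwa [compl_compl] at this

/-- The common sinc factor can be cancelled off its countable zero set; continuity of characteristic
functions fills in the rest. -/
lemma dustpan_shift_eq {t s : ℕ → ℝ} (ht : t ∈ decrL2) (hs : s ∈ decrL2) {σ τ : ℝ}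
    (h : dustpan t σ = dustpan s τ) (h0 : t 0 = s 0) :
    dustpan (fun k => t (k + 1)) σ = dustpan (fun k => s (k + 1)) τ := by
  refine LevySpace.ext (ProbabilityMeasure.toMeasure_injective (Measure.ext_of_charFun ?_))
  have hc : ∀ μ : ProbabilityMeasure ℝ, Continuous (charFun (μ : Measure ℝ)) := fun μ => by fun_prop
  refine Continuous.ext_on (dense_sinc_ne_zero (t 0)) (hc _) (hc _) fun x hx => ?_
  have hx' : (Real.sinc (t 0 * x / 2) : ℂ) ≠ 0 := Complex.ofReal_ne_zero.2 hx
  refine mul_left_cancel₀ hx' ?_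
  refine (charFun_dustpan_eq_sinc_mul ht σ x).symm.trans ?_
  rw [h, h0]
  exact charFun_dustpan_eq_sinc_mul hs τ x

/-- A DUSTPAN distribution determines the widths of its uniform summands. -/
lemma eq_of_dustpan_eq {t s : ℕ → ℝ} (ht : t ∈ decrL2) (hs : s ∈ decrL2) {σ τ : ℝ}
    (h : dustpan t σ = dustpan s τ) : t = s := by
  -- The sequences are generalized so that the induction can pass to their shifts.
  have key : ∀ (n : ℕ) (t s : ℕ → ℝ), t ∈ decrL2 → s ∈ decrL2 → dustpan t σ = dustpan s τ →
      t n = s n := by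
    intro n
    induction n with
    | zero =>
      exact fun t s ht hs h =>
        le_antisymm (le_zero_of_dustpan_eq hs ht h.symm) (le_zero_of_dustpan_eq ht hs h)
    | succ n ih =>
      exact fun t s ht hs h => ih _ _ (decrL2_shift ht) (decrL2_shift hs)
        (dustpan_shift_eq ht hs h
          (le_antisymm (le_zero_of_dustpan_eq hs ht h.symm) (le_zero_of_dustpan_eq ht hs h)))
  exact funext fun n => key n t s ht hs h

/-! ### The homeomorphism -/

lemma dustpanModuli_eq_image : dustpanModuli = stdDustpan '' dustpanParam := by
  ext μ
  constructor
  · rintro ⟨t, ht, σ, hσ, h, rfl⟩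
    refine ⟨t, ⟨ht, by nlinarith [sq_nonneg σ]⟩, ?_⟩
    rw [stdDustpan, show 1 - norm2 t ^ 2 / 12 = σ ^ 2 by linarith, Real.sqrt_sq hσ]
  · rintro ⟨t, ht, rfl⟩
    refine ⟨t, ht.1, _, Real.sqrt_nonneg _, ?_, rfl⟩
    rw [Real.sq_sqrt (by linarith [ht.2])]
    ring

lemma bijOn_stdDustpan : Set.BijOn stdDustpan dustpanParam dustpanModuli := by
  rw [dustpanModuli_eq_image]
  exact Set.InjOn.bijOn_image fun t ht s hs h => eq_of_dustpan_eq ht.1 hs.1 h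

theorem theorem1p9 :
    CompactSpace dustpanParam ∧ CompactSpace dustpanModuli ∧
      ∃ Φ : dustpanParam ≃ₜ dustpanModuli, ∀ t : dustpanParam,
        (Φ t : LevySpace) = dustpan t (Real.sqrt (1 - norm2 t ^ 2 / 12)) := by
  have hP : CompactSpace dustpanParam := isCompact_iff_compactSpace.1 isCompact_dustpanParam
  have hc : Continuous (bijOn_stdDustpan.equiv stdDustpan) :=
    continuous_stdDustpan.subtype_mk _
  let Φ : dustpanParam ≃ₜ dustpanModuli := hc.homeoOfEquivCompactToT2
  exact ⟨hP, Φ.compactSpace, Φ, fun _ => rfl⟩
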